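/- Let $r\ge 1$ and let $1\le m_k\le n_k$ be integers for $k=1,\dots,r$. Assume that $m_k<n_k$ for at least one $k$, or that $n_k\ge 2$ for at least two indices $k$. Put $\mathbb U=\mathbb R^{m_1\times\cdots\times m_r}$ and $\mathbb V=\mathbb R^{n_1\times\cdots\times n_r}$ with their Frobenius inner products. For matrices $\mathbf A=(A_1,\dots,A_r)$, $A_k\in\mathbb R^{n_k\times m_k}$, and $T\in\mathbb U$ let $\mathbf A\cdot T\in\mathbb V$ be the Tucker product, $$(\mathbf A\cdot T)_{i_1,\dots,i_r}=\sum_{j_1,\dots,j_r}(A_1)_{i_1j_1}\cdots(A_r)_{i_rj_r}\,T_{j_1,\dots,j_r}.$$ The probabilistic tensor PCA (TPCA) model is the set of distributions of all random tensors $$X=\mathbf A\cdot\nu+\mathbf A\cdot Z+\varepsilon\in\mathbb V,$$ where $Z$ is standard normal on $\mathbb U$, $\varepsilon\sim N(0,\sigma^2\,\mathrm{Id}_{\mathbb V})$ is independent of $Z$, and the parameters are arbitrary matrices $A_k\in\mathbb R^{n_k\times m_k}$, $\sigma\ge 0$, and $\nu\in\mathbb U$, where $\nu$ is either fixed to be $0$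 or free. Its members are Gaussian; identify each of them with its pair (mean, covariance), so that the model becomes a subset of a finite-dimensional real vector space, and let its dimension be the Hausdorff dimension of this (semialgebraic) set. Then the TPCA model with $\nu=0$ has dimension $$2+\sum_{k=1}^r\left(n_km_k-\binom{m_k}{2}-1\right),$$ and the TPCA model with free $\nu$ has dimension $$2+\sum_{k=1}^r\left(n_km_k-\binom{m_k}{2}-1\right)+\prod_{k=1}^r m_k .$$ -/

import Mathlib

open MeasureTheory ProbabilityTheory
open scoped ENNReal

noncomputable section

/-- The inner product space `ℝ^{n₁ × ⋯ × n_r}` of real arrays, with the Frobenius inner product. -/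
abbrev Tensor {r : ℕ} (n : Fin r → ℕ) : Type :=
  EuclideanSpace ℝ (∀ k, Fin (n k))

/-- The Tucker product
`(A · T)_{i₁,…,i_r} = ∑_{j₁,…,j_r} (A₁)_{i₁ j₁} ⋯ (A_r)_{i_r j_r} T_{j₁,…,j_r}`. -/
def tucker {r : ℕ} {n m : Fin r → ℕ} (A : ∀ k, Matrix (Fin (n k)) (Fin (m k)) ℝ)
    (T : Tensor m) : Tensor n :=
  WithLp.toLp 2 fun i => ∑ j : ∀ k, Fin (m k), (∏ k, A k (i k) (j k)) * T j

/-- The random tensor `X` on the probability space `(Ω, P)` follows the probabilistic tensor PCA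
model with parameters `A`, `ν`, `σ`: it is `X = A · ν + A · Z + ε` with `Z` standard normal,
`ε ∼ N(0, σ² I)`, and `Z`, `ε` independent. -/
def IsTPCA {r : ℕ} {n m : Fin r → ℕ} {Ω : Type} [MeasurableSpace Ω] (P : Measure Ω)
    (X : Ω → Tensor n) (A : ∀ k, Matrix (Fin (n k)) (Fin (m k)) ℝ) (ν : Tensor m) (σ : ℝ) :
    Prop :=
  ∃ (Z : Ω → Tensor m) (ε : Ω → Tensor n),
    HasLaw Z (stdGaussian (Tensor m)) P ∧
    HasLaw ε (multivariateGaussian 0 (σ ^ 2 • (1 : Matrix _ _ ℝ))) P ∧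
    IndepFun Z ε P ∧
    ∀ ω, X ω = tucker A ν + tucker A (Z ω) + ε ω

/-- The probabilistic tensor PCA model whose core mean `ν` ranges over the set `N`, as the set of
all distributions of random tensors that follow it. -/
def tpcaModel {r : ℕ} (n m : Fin r → ℕ) (N : Set (Tensor m)) : Set (Measure (Tensor n)) :=
  {Q | ∃ (Ω : Type) (_ : MeasurableSpace Ω) (P : Measure Ω) (X : Ω → Tensor n)
      (A : ∀ k, Matrix (Fin (n k)) (Fin (m k)) ℝ) (ν : Tensor m) (σ : ℝ),
      IsProbabilityMeasure P ∧ ν ∈ N ∧ 0 ≤ σ ∧ IsTPCA P X A ν σ ∧ HasLaw X Q P}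

/-- The mean and the (centred) covariance form of a distribution on a tensor space. They determine
a Gaussian distribution, so they are coordinates on every Gaussian model. -/
def meanCov {r : ℕ} {n : Fin r → ℕ} (Q : Measure (Tensor n)) :
    Tensor n × (Tensor n →L[ℝ] Tensor n →L[ℝ] ℝ) :=
  (∫ x, x ∂Q, covarianceBilin Q)

/-- The dimension of a Gaussian model: the Hausdorff dimension of the set of the pairs
(mean, covariance) of its members in the finite-dimensional space of all such pairs. On
semialgebraic sets, such as the model above, it is the usual dimension. -/
def modelDim {r : ℕ} {n : Fin r → ℕ} (M : Set (Measure (Tensor n))) : ℝ≥0∞ :=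
  dimH (meanCov '' M)

end

/-! The mean is `A · ν` and the covariance is the Kronecker product of the `A k * (A k)ᵀ` plus `σ²
I`. An orthogonal right factor of `A k` cancels in the covariance and can be absorbed into `ν`, so
`A k` may be taken lower trapezoidal (`exists_lower_mul_orthogonal`). Scaling the factors matters
only through the product of the scales, so one entry of each factor can be set to `1` and a single
scale kept (`exists_eq_smul_lowerMatrix`, `tpcaPoint_smul`). The model is thus covered by finitely
many `C¹` images of spaces of the expected dimension, which gives the upper bound. For the lower
bound, one chart has an injective derivative at a diagonal point
(`finrank_chartSpace_le_dimH_range`), and `finrank_le_dimH_range_of_injective` applies. The crux is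
that `σ² I` is not tangent to the Kronecker part (`kronecker_tangent_eq_zero`). This is where the
non-degeneracy hypothesis enters: if all `m k = n k` and at most one `n k` exceeds `1`, the
Kronecker part is already an arbitrary positive semidefinite matrix and the noise is redundant. -/

noncomputable section

/-! ### Coordinates: mean and covariance of a TPCA distribution. -/

/-- The coordinates of the mean and of the covariance of a TPCA distribution. -/
def tpcaPoint {r : ℕ} {n m : Fin r → ℕ} (A : ∀ k, Matrix (Fin (n k)) (Fin (m k)) ℝ)
    (ν : Tensor m) (σ : ℝ) :
    ((∀ k, Fin (n k)) → ℝ) × ((∀ k, Fin (n k)) → (∀ k, Fin (n k)) → ℝ) :=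
  (fun i => tucker A ν i,
    fun i i' => ∏ k, (A k * (A k).transpose) (i k) (i' k) + if i = i' then σ ^ 2 else 0)

/-- The coordinates of a vector and of a bilinear form on a tensor space. -/
def formCoords {r : ℕ} (n : Fin r → ℕ) :
    (Tensor n × (Tensor n →L[ℝ] Tensor n →L[ℝ] ℝ)) →ₗ[ℝ]
      ((∀ k, Fin (n k)) → ℝ) × ((∀ k, Fin (n k)) → (∀ k, Fin (n k)) → ℝ) where
  toFun p := (fun i => p.1 i,
    fun i i' => p.2 (EuclideanSpace.basisFun _ ℝ i) (EuclideanSpace.basisFun _ ℝ i'))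
  map_add' p q := by ext <;> simp
  map_smul' c p := by ext <;> simp

theorem formCoords_injective {r : ℕ} (n : Fin r → ℕ) : Function.Injective (formCoords n) := by
  rintro ⟨x, B⟩ ⟨y, C⟩ h
  have h1 := congrArg Prod.fst h
  have h2 := congrArg Prod.snd h
  refine Prod.ext ?_ ?_
  · ext i
    exact congrFun h1 i
  · rw [← ContinuousLinearMap.toBilinForm_inj]
    refine LinearMap.BilinForm.ext_basis (EuclideanSpace.basisFun _ ℝ).toBasis fun i j => ?_
    have := congrFun (congrFun h2 i) j
    change B _ _ = C _ _ at this
    simpa using this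

theorem sum_prod_mul_prod_eq_prod_mul_transpose {r : ℕ} {n m : Fin r → ℕ}
    (A : ∀ k, Matrix (Fin (n k)) (Fin (m k)) ℝ) (i i' : ∀ k, Fin (n k)) :
    ∑ j : ∀ k, Fin (m k), (∏ k, A k (i k) (j k)) * (∏ k, A k (i' k) (j k)) =
      ∏ k, (A k * (A k).transpose) (i k) (i' k) := by
  simp only [Matrix.mul_apply, Matrix.transpose_apply, ← Finset.prod_mul_distrib]
  exact (Fintype.prod_sum fun k j => A k (i k) j * A k (i' k) j).symm

/-- `Z` and `ε` are centred, so only `A · ν` survives in the mean; independence removes the cross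
terms of the covariance. -/
theorem formCoords_meanCov_eq_tpcaPoint {r : ℕ} {n m : Fin r → ℕ} {Ω : Type} [MeasurableSpace Ω]
    {P : Measure Ω} [IsProbabilityMeasure P] {X : Ω → Tensor n}
    {A : ∀ k, Matrix (Fin (n k)) (Fin (m k)) ℝ} {ν : Tensor m} {σ : ℝ}
    (h : IsTPCA P X A ν σ) {Q : Measure (Tensor n)} (hQ : HasLaw X Q P) :
    formCoords n (meanCov Q) = tpcaPoint A ν σ := by
  obtain ⟨Z, ε, hZ, hε, hind, hX⟩ := h
  have hZL : MemLp Z 2 P := by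
    have := IsGaussian.memLp_two_id (μ := stdGaussian (Tensor m))
    rw [← hZ.map_eq] at this
    exact (memLp_map_measure_iff aestronglyMeasurable_id hZ.aemeasurable).1 this
  have hεL : MemLp ε 2 P := by
    have := IsGaussian.memLp_two_id
      (μ := multivariateGaussian (0 : Tensor n) (σ ^ 2 • (1 : Matrix _ _ ℝ)))
    rw [← hε.map_eq] at this
    exact (memLp_map_measure_iff aestronglyMeasurable_id hε.aemeasurable).1 this
  have hZj : ∀ j, MemLp (fun ω => Z ω j) 2 P := MemLp.eval_piLp hZL
  have hεi : ∀ i, MemLp (fun ω => ε ω i) 2 P := MemLp.eval_piLp hεL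
  have hUi : ∀ i, MemLp (fun ω => tucker A (Z ω) i) 2 P := fun i => by
    simp only [tucker]
    exact memLp_finsetSum _ fun j _ => (hZj j).const_mul _
  have hXi : ∀ i, (fun ω => X ω i) = fun ω => tucker A ν i + (tucker A (Z ω) i + ε ω i) := by
    intro i; ext ω; simp [hX, add_assoc]
  have hUεi : ∀ i, MemLp (fun ω => tucker A (Z ω) i + ε ω i) 2 P := fun i =>
    MemLp.add (f := fun ω => tucker A (Z ω) i) (g := fun ω => ε ω i) (hUi i) (hεi i)
  have hXL : ∀ i, MemLp (fun ω => X ω i) 2 P := fun i => by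
    rw [hXi]
    exact MemLp.add (f := fun _ => tucker A ν i) (memLp_const _) (hUεi i)
  have hEZ : ∀ j, ∫ ω, Z ω j ∂P = 0 := fun j => by
    have h0 := hZ.integral_eq
    rw [integral_id_stdGaussian] at h0
    rw [← eval_integral_piLp fun j => (hZj j).integrable one_le_two, h0]
    simp
  have hEε : ∀ j, ∫ ω, ε ω j ∂P = 0 := fun j => by
    have h0 := hε.integral_eq
    rw [integral_id_multivariateGaussian] at h0
    rw [← eval_integral_piLp fun j => (hεi j).integrable one_le_two, h0]
    simp
  have hEU : ∀ i, ∫ ω, tucker A (Z ω) i ∂P = 0 := fun i => by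
    simp only [tucker]
    rw [integral_finsetSum _ fun j _ => ((hZj j).integrable one_le_two).const_mul _]
    simp [integral_const_mul, hEZ]
  have hps : (σ ^ 2 • (1 : Matrix (∀ k, Fin (n k)) (∀ k, Fin (n k)) ℝ)).PosSemidef :=
    Matrix.PosSemidef.one.smul (sq_nonneg σ)
  have hcε : ∀ i i', cov[fun ω => ε ω i, fun ω => ε ω i'; P] = if i = i' then σ ^ 2 else 0 := by
    intro i i'
    rw [hε.covariance_fun_comp (f := fun x => x i) (g := fun x => x i') (by fun_prop)
      (by fun_prop), covariance_eval_multivariateGaussian hps]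
    simp [Matrix.one_apply]
  have hcZ : ∀ j j', cov[fun ω => Z ω j, fun ω => Z ω j'; P] = if j = j' then 1 else 0 := by
    intro j j'
    rw [hZ.covariance_fun_comp (f := fun x => x j) (g := fun x => x j') (by fun_prop)
      (by fun_prop), ← multivariateGaussian_zero_one,
      covariance_eval_multivariateGaussian Matrix.PosSemidef.one]
    simp [Matrix.one_apply]
  have hcU : ∀ i i', cov[fun ω => tucker A (Z ω) i, fun ω => tucker A (Z ω) i'; P] =
      ∏ k, (A k * (A k).transpose) (i k) (i' k) := by
    intro i i'
    simp only [tucker]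
    rw [covariance_fun_sum_fun_sum (fun j => (hZj j).const_mul _) fun j => (hZj j).const_mul _,
      ← sum_prod_mul_prod_eq_prod_mul_transpose]
    simp only [covariance_const_mul_left, covariance_const_mul_right, hcZ]
    simp [mul_comm]
  have hUε : ∀ i i', cov[fun ω => tucker A (Z ω) i, fun ω => ε ω i'; P] = 0 := by
    intro i i'
    refine IndepFun.covariance_eq_zero ?_ (hUi i) (hεi i')
    refine hind.comp (φ := fun z => tucker A z i) (ψ := fun e => e i') ?_ (by fun_prop)
    simp only [tucker]
    fun_prop
  refine Prod.ext ?_ ?_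
  · ext i
    change (∫ x, x ∂Q) i = tucker A ν i
    rw [← hQ.integral_eq, eval_integral_piLp fun j => (hXL j).integrable one_le_two, hXi,
      integral_add (integrable_const _) ((hUεi i).integrable one_le_two),
      integral_add ((hUi i).integrable one_le_two) ((hεi i).integrable one_le_two), hEU, hEε]
    simp
  · ext i i'
    change covarianceBilin Q _ _ = _
    rw [← hQ.map_eq]
    have := covarianceBilin_apply_basisFun (X := fun i ω => X ω i) hXL i i'
    refine this.trans ?_
    rw [hXi, hXi, covariance_const_add_left ((hUεi i).integrable one_le_two),
      covariance_const_add_right ((hUεi i').integrable one_le_two)]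
    refine (covariance_add_left (hUi i) (hεi i) (hUεi i')).trans ?_
    refine (congrArg₂ (· + ·) (covariance_add_right (hUi i) (hUi i') (hεi i'))
      (covariance_add_right (hεi i) (hUi i') (hεi i'))).trans ?_
    rw [hcU, hcε, hUε,
      covariance_comm _ (fun ω => tucker A (Z ω) i'), hUε]
    simp [tpcaPoint]

theorem formCoords_image_meanCov_tpcaModel {r : ℕ} (n m : Fin r → ℕ) (N : Set (Tensor m)) :
    formCoords n '' (meanCov '' tpcaModel n m N) =
      {p | ∃ (A : ∀ k, Matrix (Fin (n k)) (Fin (m k)) ℝ) (ν : Tensor m) (σ : ℝ),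
        ν ∈ N ∧ 0 ≤ σ ∧ p = tpcaPoint A ν σ} := by
  ext p
  constructor
  · rintro ⟨_, ⟨Q, ⟨Ω, _, P, X, A, ν, σ, hP, hν, hσ, hX, hQ⟩, rfl⟩, rfl⟩
    exact ⟨A, ν, σ, hν, hσ, formCoords_meanCov_eq_tpcaPoint hX hQ⟩
  · rintro ⟨A, ν, σ, hν, hσ, rfl⟩
    let μ₁ := stdGaussian (Tensor m)
    let μ₂ := multivariateGaussian (0 : Tensor n) (σ ^ 2 • (1 : Matrix _ _ ℝ))
    let X : Tensor m × Tensor n → Tensor n := fun ω => tucker A ν + tucker A ω.1 + ω.2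
    have hX : IsTPCA (μ₁.prod μ₂) X A ν σ := by
      refine ⟨Prod.fst, Prod.snd, measurePreserving_fst.hasLaw, measurePreserving_snd.hasLaw,
        indepFun_prod measurable_id measurable_id, fun ω => rfl⟩
    have hQ : HasLaw X ((μ₁.prod μ₂).map X) (μ₁.prod μ₂) := by
      refine ⟨Measurable.aemeasurable ?_, rfl⟩
      simp only [X, tucker]
      fun_prop
    exact ⟨_, ⟨_, ⟨_, _, μ₁.prod μ₂, X, A, ν, σ, inferInstance, hν, hσ, hX, hQ⟩, rfl⟩,
      formCoords_meanCov_eq_tpcaPoint hX hQ⟩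

/-! ### Hausdorff dimension under linear and differentiable maps. -/

/-- Both the map and a linear left inverse are Lipschitz in finite dimension. -/
theorem dimH_image_of_injective {E F : Type*} [NormedAddCommGroup E] [NormedSpace ℝ E]
    [NormedAddCommGroup F] [NormedSpace ℝ F] [FiniteDimensional ℝ F]
    (G : E →ₗ[ℝ] F) (hG : Function.Injective G) (s : Set E) : dimH (G '' s) = dimH s := by
  have : FiniteDimensional ℝ E := FiniteDimensional.of_injective G hG
  obtain ⟨H, hH⟩ := G.exists_leftInverse_of_injective (LinearMap.ker_eq_bot.2 hG)
  refine le_antisymm ((LinearMap.toContinuousLinearMap G).lipschitz.dimH_image_le s) ?_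
  have h := (LinearMap.toContinuousLinearMap H).lipschitz.dimH_image_le (G '' s)
  rw [Set.image_image] at h
  simpa [show ∀ x, H (G x) = x from fun x => LinearMap.congr_fun hH x] using h

/-- The range of a map whose derivative at one point is injective has Hausdorff dimension at least
the dimension of the source. -/
theorem finrank_le_dimH_range_of_injective {E F : Type*} [NormedAddCommGroup E] [NormedSpace ℝ E]
    [FiniteDimensional ℝ E] [NormedAddCommGroup F] [NormedSpace ℝ F] [FiniteDimensional ℝ F]
    {f : E → F} {f' : E →L[ℝ] F} {a : E} (hf : HasStrictFDerivAt f f' a)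
    (hf' : Function.Injective f') : (Module.finrank ℝ E : ℝ≥0∞) ≤ dimH (Set.range f) := by
  obtain ⟨H, hH⟩ := (f' : E →ₗ[ℝ] F).exists_leftInverse_of_injective (LinearMap.ker_eq_bot.2 hf')
  have : CompleteSpace E := FiniteDimensional.complete ℝ E
  let g := LinearMap.toContinuousLinearMap H
  -- Since `g` inverts `f'` on the left, `g ∘ f` has the identity as derivative at `a`, so its range
  -- is a neighbourhood; `g` is Lipschitz and cannot raise dimension.
  have hgf : HasStrictFDerivAt (g ∘ f) (g.comp f') a := g.hasStrictFDerivAt.comp a hf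
  have hmap := hgf.map_nhds_eq_of_surj (LinearMap.range_eq_top.2 fun x =>
    ⟨x, LinearMap.congr_fun hH x⟩)
  have hmem : Set.range (g ∘ f) ∈ nhds ((g ∘ f) a) := hmap ▸ Filter.range_mem_map
  rw [← Real.dimH_of_mem_nhds hmem, Set.range_comp]
  exact g.lipschitz.dimH_image_le _

/-! ### Normal forms: trapezoidal factors and scaling. -/

/-- A real matrix with at least as many rows as columns is a lower trapezoidal matrix times an
orthogonal matrix. -/
theorem exists_lower_mul_orthogonal {n m : ℕ} (hmn : m ≤ n) (A : Matrix (Fin n) (Fin m) ℝ) :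
    ∃ (L : Matrix (Fin n) (Fin m) ℝ) (Q : Matrix (Fin m) (Fin m) ℝ),
      A = L * Q ∧ Q * Q.transpose = 1 ∧ ∀ (i : Fin n) (j : Fin m), (i : ℕ) < j → L i j = 0 := by
  let f : Fin m → EuclideanSpace ℝ (Fin m) := fun i => WithLp.toLp 2 (A (Fin.castLE hmn i))
  -- Gram-Schmidt on the first `m` rows: the basis gives the rows of `Q`, and `L` holds the
  -- coordinates of the rows of `A` in it. Row `i < m` is orthogonal to every later basis vector.
  let b := InnerProductSpace.gramSchmidtOrthonormalBasis (𝕜 := ℝ) (by simp) f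
  refine ⟨Matrix.of fun i j => inner ℝ (b j) (WithLp.toLp 2 (A i)), Matrix.of fun i j => b i j,
    ?_, ?_, ?_⟩
  · ext i j
    have h := congrArg (fun v : EuclideanSpace ℝ (Fin m) => v j)
      (b.sum_repr' (WithLp.toLp 2 (A i)))
    simpa [Matrix.mul_apply] using h.symm
  · ext i j
    have h := orthonormal_iff_ite.1 b.orthonormal i j
    simpa [Matrix.mul_apply, Matrix.one_apply, PiLp.inner_apply, mul_comm] using h
  · intro i j hij
    have h := InnerProductSpace.gramSchmidtOrthonormalBasis_inv_triangular (𝕜 := ℝ)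
      (by simp) f (i := ⟨i, hij.trans j.2⟩) (j := j) hij
    simpa [f] using h

theorem tucker_mul {r : ℕ} {n m p : Fin r → ℕ} (A : ∀ k, Matrix (Fin (n k)) (Fin (p k)) ℝ)
    (B : ∀ k, Matrix (Fin (p k)) (Fin (m k)) ℝ) (T : Tensor m) :
    tucker (fun k => A k * B k) T = tucker A (tucker B T) := by
  ext i
  simp only [tucker, Matrix.mul_apply, Finset.mul_sum, Fintype.prod_sum, Finset.sum_mul]
  rw [Finset.sum_comm]
  simp only [Finset.prod_mul_distrib, mul_assoc]

/-- The excluded positions are the pairs `i < j < m`; rows from `m` on lose nothing. -/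
theorem card_lower_add_choose {n m : ℕ} (hmn : m ≤ n) :
    Fintype.card {p : Fin n × Fin m // (p.2 : ℕ) ≤ p.1} + m.choose 2 = n * m := by
  have h := Fintype.card_subtype_compl (fun p : Fin n × Fin m => (p.2 : ℕ) ≤ p.1)
  have hle := Fintype.card_subtype_le (fun p : Fin n × Fin m => (p.2 : ℕ) ≤ p.1)
  simp only [Fintype.card_prod, Fintype.card_fin] at h hle
  suffices hc : Fintype.card {p : Fin n × Fin m // ¬ (p.2 : ℕ) ≤ p.1} = m.choose 2 by omega
  let e : {p : Fin n × Fin m // ¬ (p.2 : ℕ) ≤ p.1} ≃ Σ j : Fin m, Fin j :=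
    { toFun := fun p => ⟨p.1.2, ⟨p.1.1, not_le.1 p.2⟩⟩
      invFun := fun q => ⟨(⟨q.2, q.2.2.trans (q.1.2.trans_le hmn)⟩, q.1), not_le.2 q.2.2⟩
      left_inv := fun _ => rfl
      right_inv := fun _ => rfl }
  rw [Fintype.card_congr e, Fintype.card_sigma]
  simp only [Fintype.card_fin]
  rw [Fin.sum_univ_eq_sum_range (fun j => j) m, Finset.sum_range_id, Nat.choose_two_right]

/-- The positions of the entries of a lower trapezoidal matrix. -/
abbrev LowerIdx (n m : ℕ) : Type := {p : Fin n × Fin m // (p.2 : ℕ) ≤ p.1}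

/-- The lower trapezoidal matrix whose entry at `c` is `e` and whose other entries on and below
the diagonal are given by `x`. -/
def lowerMatrix {n m : ℕ} (c : LowerIdx n m) (e : ℝ) (x : {p : LowerIdx n m // p ≠ c} → ℝ) :
    Matrix (Fin n) (Fin m) ℝ :=
  Matrix.of fun i j =>
    if h : (j : ℕ) ≤ i then
      if h' : (⟨(i, j), h⟩ : LowerIdx n m) ≠ c then x ⟨_, h'⟩ else e
    else 0

theorem lowerMatrix_add_smul {n m : ℕ} (c : LowerIdx n m) (x y : {p : LowerIdx n m // p ≠ c} → ℝ)
    (u : ℝ) (i : Fin n) (j : Fin m) :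
    lowerMatrix c 1 (x + u • y) i j = lowerMatrix c 1 x i j + u * lowerMatrix c 0 y i j := by
  simp only [lowerMatrix, Matrix.of_apply]
  split_ifs <;> simp

/-- Divide by any nonzero entry. The fallback `c₀` serves only the zero matrix, which has scale `0`.
-/
theorem exists_eq_smul_lowerMatrix {n m : ℕ} (c₀ : LowerIdx n m) (L : Matrix (Fin n) (Fin m) ℝ)
    (hL : ∀ (i : Fin n) (j : Fin m), (i : ℕ) < j → L i j = 0) :
    ∃ (c : LowerIdx n m) (s : ℝ) (x : {p : LowerIdx n m // p ≠ c} → ℝ),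
      L = s • lowerMatrix c 1 x := by
  by_cases h : ∃ c : LowerIdx n m, L c.1.1 c.1.2 ≠ 0
  · obtain ⟨c, hc⟩ := h
    refine ⟨c, L c.1.1 c.1.2, fun p => L p.1.1.1 p.1.1.2 / L c.1.1 c.1.2, ?_⟩
    ext i j
    simp only [lowerMatrix, Matrix.smul_apply, Matrix.of_apply, smul_eq_mul]
    split_ifs with h1 h2
    · field_simp
    · rw [not_not] at h2
      simp [← h2]
    · simp [hL i j (not_le.1 h1)]
  · push Not at h
    refine ⟨c₀, 0, 0, ?_⟩
    ext i j
    rcases le_or_gt (j : ℕ) i with hij | hij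
    · simpa using h ⟨(i, j), hij⟩
    · simpa using hL i j hij

theorem tpcaPoint_smul {r : ℕ} {n m : Fin r → ℕ} (s : Fin r → ℝ)
    (A : ∀ k, Matrix (Fin (n k)) (Fin (m k)) ℝ) (ν : Tensor m) (σ : ℝ) :
    tpcaPoint (fun k => s k • A k) ν σ =
      (fun i => (∏ k, s k) * tucker A ν i, fun i i' =>
        (∏ k, s k) ^ 2 * ∏ k, (A k * (A k).transpose) (i k) (i' k) +
          if i = i' then σ ^ 2 else 0) := by
  refine Prod.ext ?_ ?_
  · ext i
    simp [tpcaPoint, tucker, Finset.prod_mul_distrib, Finset.mul_sum, mul_assoc]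
  · ext i i'
    simp [tpcaPoint, Finset.prod_mul_distrib, pow_two, mul_assoc]

theorem tpcaPoint_mul {r : ℕ} {n m : Fin r → ℕ} (L : ∀ k, Matrix (Fin (n k)) (Fin (m k)) ℝ)
    (Q : ∀ k, Matrix (Fin (m k)) (Fin (m k)) ℝ) (hQ : ∀ k, Q k * (Q k).transpose = 1)
    (ν : Tensor m) (σ : ℝ) :
    tpcaPoint (fun k => L k * Q k) ν σ = tpcaPoint L (tucker Q ν) σ := by
  have h : ∀ k, L k * Q k * (L k * Q k).transpose = L k * (L k).transpose := fun k => by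
    rw [Matrix.transpose_mul, Matrix.mul_assoc, ← Matrix.mul_assoc (Q k), hQ, Matrix.one_mul]
  simp only [tpcaPoint, h, tucker_mul]

/-! ### Charts covering the model. -/

/-- The parameters of a chart of the TPCA model: the free entries of the lower trapezoidal
matrices, the common scale, the standard deviation of the noise and the core mean. -/
abbrev ChartSpace {r : ℕ} {n m : Fin r → ℕ} (c : ∀ k, LowerIdx (n k) (m k))
    (W : Submodule ℝ (Tensor m)) : Type :=
  (∀ k, {p : LowerIdx (n k) (m k) // p ≠ c k} → ℝ) × ℝ × ℝ × W

/-- The chart of the TPCA model in which the entry at `c k` of the `k`-th matrix is `1`. -/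
def chartMap {r : ℕ} {n m : Fin r → ℕ} (c : ∀ k, LowerIdx (n k) (m k))
    (W : Submodule ℝ (Tensor m)) (p : ChartSpace c W) :
    ((∀ k, Fin (n k)) → ℝ) × ((∀ k, Fin (n k)) → (∀ k, Fin (n k)) → ℝ) :=
  (fun i => p.2.1 * tucker (fun k => lowerMatrix (c k) 1 (p.1 k)) (p.2.2.2 : Tensor m) i,
    fun i i' => p.2.1 ^ 2 * ∏ k, (lowerMatrix (c k) 1 (p.1 k) *
      (lowerMatrix (c k) 1 (p.1 k)).transpose) (i k) (i' k) + if i = i' then p.2.2.1 ^ 2 else 0)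

theorem contDiff_chartMap {r : ℕ} {n m : Fin r → ℕ} (c : ∀ k, LowerIdx (n k) (m k))
    (W : Submodule ℝ (Tensor m)) : ContDiff ℝ 1 (chartMap c W) := by
  have hentry : ∀ k i j, ContDiff ℝ 1
      fun p : ChartSpace c W => lowerMatrix (c k) 1 (p.1 k) i j := fun k i j => by
    simp only [lowerMatrix, Matrix.of_apply]
    split_ifs with h h'
    · have hx : ContDiff ℝ 1 fun p : ChartSpace c W => p.1 k := contDiff_pi.1 contDiff_fst k
      exact contDiff_pi.1 hx ⟨⟨(i, j), h⟩, h'⟩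
    · exact contDiff_const
    · exact contDiff_const
  have hν : ∀ j, ContDiff ℝ 1 fun p : ChartSpace c W => (p.2.2.2 : Tensor m) j := fun j =>
    ((EuclideanSpace.proj j).comp W.subtypeL).contDiff.comp
      (contDiff_snd.comp (contDiff_snd.comp contDiff_snd))
  refine ContDiff.prodMk (contDiff_pi.2 fun i => ?_)
    (contDiff_pi.2 fun i => contDiff_pi.2 fun i' => ?_)
  · simp only [tucker]
    exact ContDiff.mul (by fun_prop) (ContDiff.sum fun j _ =>
      (contDiff_prod fun k _ => hentry k _ _).mul (hν j))
  · simp only [Matrix.mul_apply, Matrix.transpose_apply]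
    refine ContDiff.add (ContDiff.mul (by fun_prop) (contDiff_prod fun k _ =>
      ContDiff.sum fun j _ => (hentry k _ _).mul (hentry k _ _))) ?_
    split_ifs <;> fun_prop

theorem finrank_chartSpace {r : ℕ} {n m : Fin r → ℕ} (hmn : ∀ k, m k ≤ n k)
    (c : ∀ k, LowerIdx (n k) (m k)) (W : Submodule ℝ (Tensor m)) :
    (Module.finrank ℝ (ChartSpace c W) : ℤ) =
      2 + ∑ k, ((n k : ℤ) * (m k : ℤ) - ((m k).choose 2 : ℤ) - 1) + Module.finrank ℝ W := by
  have hk : ∀ k, (Fintype.card {p : LowerIdx (n k) (m k) // p ≠ c k} : ℤ) =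
      (n k : ℤ) * (m k : ℤ) - ((m k).choose 2 : ℤ) - 1 := fun k => by
    have h1 : (Fintype.card (LowerIdx (n k) (m k)) : ℤ) + (m k).choose 2 = n k * m k :=
      mod_cast card_lower_add_choose (hmn k)
    have h2 : Fintype.card {p : LowerIdx (n k) (m k) // p ≠ c k} =
        Fintype.card (LowerIdx (n k) (m k)) - 1 := by
      simp
    have h3 : 0 < Fintype.card (LowerIdx (n k) (m k)) := Fintype.card_pos_iff.2 ⟨c k⟩
    rw [h2]
    push_cast [Nat.cast_sub h3]
    linarith
  simp only [Module.finrank_prod, Module.finrank_pi_fintype, Module.finrank_self, ← hk]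
  push_cast
  simp
  ring

theorem tpcaPoint_mem_iUnion_range_chartMap {r : ℕ} {n m : Fin r → ℕ} (hm : ∀ k, 1 ≤ m k)
    (hmn : ∀ k, m k ≤ n k) (W : Submodule ℝ (Tensor m))
    (hW : ∀ (Q : ∀ k, Matrix (Fin (m k)) (Fin (m k)) ℝ), ∀ ν ∈ W, tucker Q ν ∈ W)
    (A : ∀ k, Matrix (Fin (n k)) (Fin (m k)) ℝ) (ν : Tensor m) (hν : ν ∈ W) (σ : ℝ) :
    tpcaPoint A ν σ ∈ ⋃ c : ∀ k, LowerIdx (n k) (m k), Set.range (chartMap c W) := by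
  choose L Q hA hQ hL using fun k => exists_lower_mul_orthogonal (hmn k) (A k)
  choose c s x hx using fun k => exists_eq_smul_lowerMatrix
    ⟨(⟨0, (hm k).trans (hmn k)⟩, ⟨0, hm k⟩), le_rfl⟩ (L k) (hL k)
  refine Set.mem_iUnion.2 ⟨c, ⟨x, ∏ k, s k, σ, ⟨tucker Q ν, hW Q ν hν⟩⟩, ?_⟩
  have hA' : A = fun k => L k * Q k := funext hA
  have hL' : L = fun k => s k • lowerMatrix (c k) 1 (x k) := funext hx
  rw [hA', tpcaPoint_mul L Q hQ, hL', tpcaPoint_smul]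
  rfl

theorem exists_tpcaPoint_eq_chartMap {r : ℕ} {n m : Fin r → ℕ} (k₀ : Fin r)
    (c : ∀ k, LowerIdx (n k) (m k)) (W : Submodule ℝ (Tensor m)) (p : ChartSpace c W) :
    ∃ (A : ∀ k, Matrix (Fin (n k)) (Fin (m k)) ℝ) (ν : Tensor m) (σ : ℝ),
      ν ∈ W ∧ 0 ≤ σ ∧ chartMap c W p = tpcaPoint A ν σ := by
  -- The common scale is put entirely into the factor `k₀`; only the square of the noise parameter
  -- matters, so its sign can be dropped.
  refine ⟨fun k => (if k = k₀ then p.2.1 else 1) • lowerMatrix (c k) 1 (p.1 k), p.2.2.2,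
    |p.2.2.1|, p.2.2.2.2, abs_nonneg _, ?_⟩
  rw [tpcaPoint_smul]
  simp [chartMap]

/-! ### Injectivity of the derivative of a chart. -/

/-- A linear relation between the identity matrix and the tangent vectors `T k` at the Kronecker
product of the matrices `S k`, normalised at the diagonal entries `z`, is trivial. -/
theorem kronecker_tangent_eq_zero {r : ℕ} {n : Fin r → ℕ}
    (S T : ∀ k, Matrix (Fin (n k)) (Fin (n k)) ℝ) (z : ∀ k, Fin (n k)) (τ ρ : ℝ)
    (hSz : ∀ k, S k (z k) (z k) = 1) (hTz : ∀ k, T k (z k) (z k) = 0)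
    (hrel : ∀ i i' : ∀ k, Fin (n k), 2 * τ * ∏ k, S k (i k) (i' k) +
      ∑ k, (∏ l ∈ Finset.univ.erase k, S l (i l) (i' l)) * T k (i k) (i' k) +
        (if i = i' then 2 * ρ else 0) = 0)
    (hns : (∃ k a, S k a a = 0 ∧ T k a a = 0) ∨
      ∃ k l, k ≠ l ∧ (∃ a, S k a a ≠ 1) ∧ ∃ b, S l b b ≠ 1) :
    τ = 0 ∧ ρ = 0 ∧ ∀ k, T k = 0 := by
  have hz : τ + ρ = 0 := by
    have h := hrel z z
    simp [hSz, hTz] at h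
    linarith
  -- Multi-indices that differ from `z` only at `k` isolate the `k`-th factor, since there all other
  -- `S` are `1` and all other `T` are `0`.
  have hone : ∀ k a b, 2 * τ * S k a b + T k a b + (if a = b then 2 * ρ else 0) = 0 := by
    intro k a b
    have h := hrel (Function.update z k a) (Function.update z k b)
    rw [Fintype.prod_eq_single k fun l hl => by simp [hl, hSz],
      Fintype.sum_eq_single k fun l hl => by simp [hl, hTz],
      Finset.prod_eq_one fun l hl => by simp [Finset.ne_of_mem_erase hl, hSz]] at h
    simpa [(Function.update_injective z k).eq_iff] using h
  have hdiag : ∀ k a, T k a a = 2 * τ * (1 - S k a a) := fun k a => by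
    have h := hone k a a
    simp only [if_true] at h
    linear_combination h - 2 * hz
  have hτ : τ = 0 := by
    rcases hns with ⟨k, a, hSa, hTa⟩ | ⟨k, l, hkl, ⟨a, ha⟩, b, hb⟩
    · have h := hdiag k a
      rw [hSa, hTa] at h
      linarith
    -- Moving two coordinates away from `z` and substituting `hdiag` leaves `τ (S k a a - 1) (S l b
    -- b - 1) = 0`.
    · let i := Function.update (Function.update z k a) l b
      have hik : i k = a := by simp [i, hkl]
      have hil : i l = b := by simp [i]
      have hio : ∀ q, q ≠ k → q ≠ l → i q = z q := fun q h1 h2 => by simp [i, h1, h2]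
      have h := hrel i i
      rw [Fintype.prod_eq_mul k l hkl fun q hq => by rw [hio q hq.1 hq.2, hSz],
        Fintype.sum_eq_add k l hkl fun q hq => by rw [hio q hq.1 hq.2, hTz, mul_zero],
        Finset.prod_eq_single_of_mem l (by simp [hkl.symm]) fun q hq hql => by
          rw [hio q (Finset.ne_of_mem_erase hq) hql, hSz],
        Finset.prod_eq_single_of_mem k (by simp [hkl]) fun q hq hqk => by
          rw [hio q hqk (Finset.ne_of_mem_erase hq), hSz], hik, hil, if_pos rfl, hdiag k a,
        hdiag l b] at h
      have h' : τ * ((S k a a - 1) * (S l b b - 1)) = 0 := by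
        linear_combination -(1 / 2) * h + hz
      have h1 := sub_ne_zero.2 ha
      have h2 := sub_ne_zero.2 hb
      simpa [h1, h2] using h'
  have hρ : ρ = 0 := by linarith
  refine ⟨hτ, hρ, fun k => ?_⟩
  ext a b
  simpa [hτ, hρ] using hone k a b

/-- The diagonal of the matrices at which the derivative of a chart is computed. -/
def baseDiag (a : ℕ) : ℝ := if a = 0 then 1 else 2

theorem baseDiag_ne_zero (a : ℕ) : baseDiag a ≠ 0 := by
  unfold baseDiag; split_ifs <;> norm_num

/-- The rectangular diagonal matrix with diagonal `1, 2, 2, …`. -/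
def baseMatrix (n m : ℕ) : Matrix (Fin n) (Fin m) ℝ :=
  Matrix.of fun i j => if (i : ℕ) = j then baseDiag i else 0

/-- The top left position of a lower trapezoidal matrix. -/
def cornerIdx {n m : ℕ} (hm : 1 ≤ m) (hmn : m ≤ n) : LowerIdx n m :=
  ⟨(⟨0, hm.trans hmn⟩, ⟨0, hm⟩), le_rfl⟩

/-- The free entries of `baseMatrix`. -/
def baseEntries {n m : ℕ} (c : LowerIdx n m) (p : {p : LowerIdx n m // p ≠ c}) : ℝ :=
  if (p.1.1.1 : ℕ) = p.1.1.2 then 2 else 0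

theorem lowerMatrix_baseEntries {n m : ℕ} (hm : 1 ≤ m) (hmn : m ≤ n) :
    lowerMatrix (cornerIdx hm hmn) 1 (baseEntries _) = baseMatrix n m := by
  ext i j
  simp only [lowerMatrix, baseMatrix, baseEntries, baseDiag, cornerIdx, Matrix.of_apply, ne_eq,
    Subtype.mk.injEq, Prod.mk.injEq, Fin.ext_iff]
  split_ifs <;> grind

theorem sum_mul_baseMatrix {n m : ℕ} (x : Fin m → ℝ) (b : Fin n) :
    ∑ j, x j * baseMatrix n m b j = if h : (b : ℕ) < m then x ⟨b, h⟩ * baseDiag b else 0 := by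
  simp only [baseMatrix, Matrix.of_apply]
  split_ifs with h
  · rw [Fintype.sum_eq_single ⟨b, h⟩]
    · simp
    · intro j hj
      rw [if_neg fun hb => hj (Fin.ext hb.symm), mul_zero]
  · refine Finset.sum_eq_zero fun j _ => ?_
    rw [if_neg fun hb => h (hb.trans_lt j.2), mul_zero]

theorem baseMatrix_mul_transpose_apply_self {n m : ℕ} (a : Fin n) :
    (baseMatrix n m * (baseMatrix n m).transpose) a a =
      if (a : ℕ) < m then baseDiag a ^ 2 else 0 := by
  simp only [Matrix.mul_apply, Matrix.transpose_apply, sum_mul_baseMatrix]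
  split_ifs <;> simp [baseMatrix, pow_two]

theorem mul_transpose_baseMatrix_add_apply_self {n m : ℕ} (D : Matrix (Fin n) (Fin m) ℝ)
    (a : Fin n) :
    (D * (baseMatrix n m).transpose + baseMatrix n m * D.transpose) a a =
      if h : (a : ℕ) < m then 2 * (D a ⟨a, h⟩ * baseDiag a) else 0 := by
  simp only [Matrix.add_apply, Matrix.mul_apply, Matrix.transpose_apply,
    mul_comm (baseMatrix n m a _), sum_mul_baseMatrix]
  split_ifs <;> ring

theorem lowerMatrix_zero_apply_of_lt {n m : ℕ} (c : LowerIdx n m)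
    (x : {p : LowerIdx n m // p ≠ c} → ℝ) {i : Fin n} {j : Fin m} (h : (i : ℕ) < j) :
    lowerMatrix c 0 x i j = 0 := by
  simp [lowerMatrix, h]

/-- With `D` the trapezoidal direction, the entry `(a, b)` of the tangent, `b < a`, is `D a b` times
a nonzero diagonal value: the transposed term vanishes because `D` is zero above the diagonal. For
`a = b` the two terms agree and add up. -/
theorem eq_zero_of_tangent_eq_zero {n m : ℕ} (hmn : m ≤ n) (c : LowerIdx n m)
    (x : {p : LowerIdx n m // p ≠ c} → ℝ)
    (h : lowerMatrix c 0 x * (baseMatrix n m).transpose +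
      baseMatrix n m * (lowerMatrix c 0 x).transpose = 0) : x = 0 := by
  funext ⟨⟨⟨a, b⟩, hab⟩, hp⟩
  have hval : lowerMatrix c 0 x a b = x ⟨⟨⟨a, b⟩, hab⟩, hp⟩ := by
    simp only [lowerMatrix, Matrix.of_apply]
    rw [dif_pos hab, dif_pos hp]
  have h' := congrFun (congrFun h a) (Fin.castLE hmn b)
  simp only [Matrix.add_apply, Matrix.mul_apply, Matrix.transpose_apply, Matrix.zero_apply,
    sum_mul_baseMatrix, Fin.val_castLE, b.2, dif_pos, Fin.eta] at h'
  simp only [mul_comm (baseMatrix n m a _), sum_mul_baseMatrix] at h'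
  rw [← hval]
  have hb := baseDiag_ne_zero b
  rcases hab.lt_or_eq with hlt | heq
  · have h2 : (if h : (a : ℕ) < m then
        lowerMatrix c 0 x (Fin.castLE hmn b) ⟨a, h⟩ * baseDiag a else 0) = 0 := by
      split_ifs with ha
      · rw [lowerMatrix_zero_apply_of_lt c x (by simpa using hlt), zero_mul]
      · rfl
    rw [h2, add_zero] at h'
    simpa [hb] using h'
  · obtain rfl : a = Fin.castLE hmn b := Fin.ext heq.symm
    simp only [Fin.val_castLE, b.2, dif_pos, Fin.eta] at h'
    have : lowerMatrix c 0 x (Fin.castLE hmn b) b * baseDiag b = 0 := by linarith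
    simpa [hb] using this

theorem tucker_baseMatrix_injective {r : ℕ} {n m : Fin r → ℕ} (hmn : ∀ k, m k ≤ n k)
    (ν : Tensor m) (h : ∀ i, tucker (fun k => baseMatrix (n k) (m k)) ν i = 0) : ν = 0 := by
  ext j
  have hj := h fun k => Fin.castLE (hmn k) (j k)
  simp only [tucker] at hj
  rw [Fintype.sum_eq_single j] at hj
  · have hp : ∏ k, baseMatrix (n k) (m k) (Fin.castLE (hmn k) (j k)) (j k) ≠ 0 :=
      Finset.prod_ne_zero_iff.2 fun k _ => by simpa [baseMatrix] using baseDiag_ne_zero _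
    simpa [hp] using hj
  · intro j' hj'
    obtain ⟨k, hk⟩ := Function.ne_iff.1 hj'
    have hk' : (j k : ℕ) ≠ j' k := fun h => hk (Fin.ext h.symm)
    rw [Finset.prod_eq_zero (Finset.mem_univ k) (by simp [baseMatrix, hk']), zero_mul]

theorem finrank_chartSpace_le_dimH_range {r : ℕ} {n m : Fin r → ℕ}
    (hm : ∀ k, 1 ≤ m k) (hmn : ∀ k, m k ≤ n k)
    (hns : (∃ k, m k < n k) ∨ ∃ k l, k ≠ l ∧ 2 ≤ n k ∧ 2 ≤ n l) (W : Submodule ℝ (Tensor m)) :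
    (Module.finrank ℝ (ChartSpace (fun k => cornerIdx (hm k) (hmn k)) W) : ℝ≥0∞) ≤
      dimH (Set.range (chartMap (fun k => cornerIdx (hm k) (hmn k)) W)) := by
  set c : ∀ k, LowerIdx (n k) (m k) := fun k => cornerIdx (hm k) (hmn k) with hc
  -- Scale and noise enter through their squares, so they are taken nonzero here to have nonzero
  -- derivatives.
  let a : ChartSpace c W := (fun k => baseEntries (c k), 1, 1, 0)
  have hf := (contDiff_chartMap c W).contDiffAt (x := a) |>.hasStrictFDerivAt one_ne_zero
  refine finrank_le_dimH_range_of_injective hf ?_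
  rw [injective_iff_map_eq_zero]
  rintro v hv
  obtain ⟨x, τ, ρ, ν⟩ := v
  -- A kernel vector of the derivative is studied through the chart along a line, where the product
  -- rule gives the relation `hrel`.
  have hline : HasDerivAt (fun u : ℝ => chartMap c W (a + u • (x, τ, ρ, ν))) 0 0 := by
    have h1 : HasDerivAt (fun u : ℝ => a + u • ((x, τ, ρ, ν) : ChartSpace c W))
        (x, τ, ρ, ν) 0 := by
      simpa using ((hasDerivAt_id (0 : ℝ)).smul_const
        ((x, τ, ρ, ν) : ChartSpace c W)).const_add a
    have h2 := HasFDerivAt.comp_hasDerivAt_of_eq 0 hf.hasFDerivAt h1 (by simp)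
    rwa [hv] at h2
  have hmat : ∀ k (u : ℝ) i j, lowerMatrix (c k) 1 ((a + u • ((x, τ, ρ, ν) : ChartSpace c W)).1 k)
      i j = baseMatrix (n k) (m k) i j + u * lowerMatrix (c k) 0 (x k) i j := fun k u i j => by
    rw [← lowerMatrix_baseEntries (hm k) (hmn k)]
    exact lowerMatrix_add_smul _ _ _ u i j
  let S : ∀ k, Matrix (Fin (n k)) (Fin (n k)) ℝ := fun k =>
    baseMatrix (n k) (m k) * (baseMatrix (n k) (m k)).transpose
  let T : ∀ k, Matrix (Fin (n k)) (Fin (n k)) ℝ := fun k =>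
    lowerMatrix (c k) 0 (x k) * (baseMatrix (n k) (m k)).transpose +
      baseMatrix (n k) (m k) * (lowerMatrix (c k) 0 (x k)).transpose
  have hS : ∀ k i j, HasDerivAt (fun u : ℝ =>
      (lowerMatrix (c k) 1 ((a + u • ((x, τ, ρ, ν) : ChartSpace c W)).1 k) *
      (lowerMatrix (c k) 1 ((a + u • ((x, τ, ρ, ν) : ChartSpace c W)).1 k)).transpose) i j)
      (T k i j) 0 := fun k i j => by
    simp only [Matrix.mul_apply, Matrix.transpose_apply, hmat, T, Matrix.add_apply,
      ← Finset.sum_add_distrib]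
    refine HasDerivAt.fun_sum fun l _ => ?_
    have h1 : ∀ i, HasDerivAt (fun u : ℝ => baseMatrix (n k) (m k) i l +
        u * lowerMatrix (c k) 0 (x k) i l) (lowerMatrix (c k) 0 (x k) i l) 0 := fun i => by
      simpa using ((hasDerivAt_id (0 : ℝ)).mul_const (lowerMatrix (c k) 0 (x k) i l)).const_add
        (baseMatrix (n k) (m k) i l)
    simpa using (h1 i).fun_mul (h1 j)
  have hS0 : ∀ k, lowerMatrix (c k) 1 ((a + (0 : ℝ) • ((x, τ, ρ, ν) : ChartSpace c W)).1 k) *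
      (lowerMatrix (c k) 1 ((a + (0 : ℝ) • ((x, τ, ρ, ν) : ChartSpace c W)).1 k)).transpose =
      S k := fun k => by
    ext i j
    simp only [S, Matrix.mul_apply, Matrix.transpose_apply, hmat, zero_mul, add_zero]
  have hlin : ∀ y : ℝ, HasDerivAt (fun u : ℝ => (1 + u * y) ^ 2) (2 * y) 0 := fun y => by
    simpa using (((hasDerivAt_id (0 : ℝ)).mul_const y).const_add 1).fun_pow 2
  have hrel : ∀ i i' : ∀ k, Fin (n k), 2 * τ * ∏ k, S k (i k) (i' k) +
      ∑ k, (∏ l ∈ Finset.univ.erase k, S l (i l) (i' l)) * T k (i k) (i' k) +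
        (if i = i' then 2 * ρ else 0) = 0 := by
    intro i i'
    have h1 := HasDerivAt.fun_finsetProd (u := Finset.univ) fun k _ => hS k (i k) (i' k)
    have h2 := (hlin τ).mul h1
    have h3 : HasDerivAt (fun u : ℝ => if i = i' then (1 + u * ρ) ^ 2 else 0)
        (if i = i' then 2 * ρ else 0) 0 := by
      split_ifs
      · exact hlin ρ
      · exact hasDerivAt_const _ _
    have h4 := h2.add h3
    have h5 := hasDerivAt_pi.1 (hasDerivAt_pi.1 hline.snd i) i'
    have h6 := h4.unique h5
    simp only [hS0] at h6
    simpa using h6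
  have hSz : ∀ k, S k ⟨0, (hm k).trans (hmn k)⟩ ⟨0, (hm k).trans (hmn k)⟩ = 1 := by
    intro k
    have h0 : 0 < m k := hm k
    simp only [S, baseMatrix_mul_transpose_apply_self]
    simp [h0, baseDiag]
  have hTz : ∀ k, T k ⟨0, (hm k).trans (hmn k)⟩ ⟨0, (hm k).trans (hmn k)⟩ = 0 := by
    intro k
    have h0 : 0 < m k := hm k
    simp only [T, mul_transpose_baseMatrix_add_apply_self]
    simp [h0, lowerMatrix, hc, cornerIdx]
  have hST : (∃ k a, S k a a = 0 ∧ T k a a = 0) ∨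
      ∃ k l, k ≠ l ∧ (∃ a, S k a a ≠ 1) ∧ ∃ b, S l b b ≠ 1 := by
    rcases hns with ⟨k, hk⟩ | ⟨k, l, hkl, hk, hl⟩
    -- Row `m k` of `baseMatrix` is zero.
    · refine Or.inl ⟨k, ⟨m k, hk⟩, ?_, ?_⟩
      · simp only [S, baseMatrix_mul_transpose_apply_self]
        simp
      · simp only [T, mul_transpose_baseMatrix_add_apply_self]
        simp
    -- The second diagonal entry of `S k` is `4` or `0`; this is why `baseDiag` takes the value `2`
    -- rather than `1`.
    · have h1 : ∀ k (hk : 2 ≤ n k), S k ⟨1, hk⟩ ⟨1, hk⟩ ≠ 1 := fun k hk => by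
        simp only [S, baseMatrix_mul_transpose_apply_self]
        split_ifs <;> norm_num [baseDiag]
      exact Or.inr ⟨k, l, hkl, ⟨_, h1 k hk⟩, _, h1 l hl⟩
  obtain ⟨hτ, hρ, hT⟩ := kronecker_tangent_eq_zero S T _ τ ρ hSz hTz hrel hST
  have hx : x = 0 := funext fun k => eq_zero_of_tangent_eq_zero (hmn k) (c k) (x k) (hT k)
  have hν : (ν : Tensor m) = 0 := by
    refine tucker_baseMatrix_injective hmn _ fun i => ?_
    have h1 := hasDerivAt_pi.1 hline.fst i
    have h2 : HasDerivAt (fun u : ℝ => u * tucker (fun k => baseMatrix (n k) (m k)) (ν : Tensor m)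
        i) (tucker (fun k => baseMatrix (n k) (m k)) (ν : Tensor m) i) 0 := by
      simpa using (hasDerivAt_id (0 : ℝ)).mul_const
        (tucker (fun k => baseMatrix (n k) (m k)) (ν : Tensor m) i)
    -- Once `x = 0` and `τ = 0`, the mean is exactly linear along the line.
    refine h2.unique (h1.congr_of_eventuallyEq (Filter.Eventually.of_forall fun u => ?_))
    simp only [chartMap, tucker, hmat]
    simp only [hx, hτ, a]
    have hl : ∀ k i j, lowerMatrix (c k) 0 (0 : {p // p ≠ c k} → ℝ) i j = 0 := by
      intro k i j
      simp [lowerMatrix]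
    simp [hl, Finset.mul_sum, mul_left_comm]
  rw [hx, hτ, hρ, show ν = 0 from Subtype.ext hν]
  rfl

end

/-! ### The dimension of the model. -/

/-- A subspace `W` of core means treats both cases at once, as `⊥` and `⊤`; stability under `tucker
Q` lets the orthogonal factors be absorbed. -/
theorem modelDim_tpcaModel_eq_finrank {r : ℕ} (n m : Fin r → ℕ)
    (hm : ∀ k, 1 ≤ m k) (hmn : ∀ k, m k ≤ n k)
    (hns : (∃ k, m k < n k) ∨ ∃ k l, k ≠ l ∧ 2 ≤ n k ∧ 2 ≤ n l) (W : Submodule ℝ (Tensor m))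
    (hW : ∀ (Q : ∀ k, Matrix (Fin (m k)) (Fin (m k)) ℝ), ∀ ν ∈ W, tucker Q ν ∈ W) {d : ℕ}
    (hd : (d : ℤ) = 2 + ∑ k, ((n k : ℤ) * (m k : ℤ) - ((m k).choose 2 : ℤ) - 1)) :
    modelDim (tpcaModel n m W) = ((d + Module.finrank ℝ W : ℕ) : ℝ≥0∞) := by
  have hrank : ∀ c : ∀ k, LowerIdx (n k) (m k),
      Module.finrank ℝ (ChartSpace c W) = d + Module.finrank ℝ W := fun c => by
    have := finrank_chartSpace hmn c W
    rw [← hd] at this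
    exact_mod_cast this
  have hcoords := dimH_image_of_injective
    (E := Tensor n × (Tensor n →L[ℝ] Tensor n →L[ℝ] ℝ)) (formCoords n) (formCoords_injective n)
    (meanCov '' tpcaModel n m W)
  refine hcoords.symm.trans ?_
  rw [formCoords_image_meanCov_tpcaModel]
  apply le_antisymm
  · refine (dimH_mono (t := ⋃ c : ∀ k, LowerIdx (n k) (m k), Set.range (chartMap c W)) ?_).trans ?_
    · rintro _ ⟨A, ν, σ, hν, -, rfl⟩
      exact tpcaPoint_mem_iUnion_range_chartMap hm hmn W hW A ν hν σ
    · rw [dimH_iUnion]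
      refine iSup_le fun c => ?_
      rw [← hrank c]
      exact (contDiff_chartMap c W).dimH_range_le
  · obtain ⟨k₀⟩ : Nonempty (Fin r) := by
      rcases hns with ⟨k, -⟩ | ⟨k, -⟩ <;> exact ⟨k⟩
    rw [← hrank fun k => cornerIdx (hm k) (hmn k)]
    refine (finrank_chartSpace_le_dimH_range hm hmn hns W).trans (dimH_mono ?_)
    rintro _ ⟨p, rfl⟩
    exact exists_tpcaPoint_eq_chartMap k₀ _ W p

theorem mainTheorem12 {r : ℕ} (n m : Fin r → ℕ)
    (hm : ∀ k, 1 ≤ m k) (hmn : ∀ k, m k ≤ n k)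
    (hns : (∃ k, m k < n k) ∨ ∃ k l, k ≠ l ∧ 2 ≤ n k ∧ 2 ≤ n l) :
    ∃ d : ℕ,
      (d : ℤ) = 2 + ∑ k, ((n k : ℤ) * (m k : ℤ) - ((m k).choose 2 : ℤ) - 1) ∧
      modelDim (tpcaModel n m {0}) = (d : ENNReal) ∧
      modelDim (tpcaModel n m Set.univ) = ((d + ∏ k, m k : ℕ) : ENNReal) := by
  -- The integer formula is nonnegative because it is the dimension of a chart space with `W = ⊥`.
  obtain ⟨d, hd⟩ : ∃ d : ℕ,
      (d : ℤ) = 2 + ∑ k, ((n k : ℤ) * (m k : ℤ) - ((m k).choose 2 : ℤ) - 1) :=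
    ⟨_, (finrank_chartSpace hmn (fun k => cornerIdx (hm k) (hmn k)) ⊥).trans (by simp)⟩
  refine ⟨d, hd, ?_, ?_⟩
  · have h := modelDim_tpcaModel_eq_finrank n m hm hmn hns ⊥ (fun Q ν hν => ?_) hd
    · simpa using h
    · rw [Submodule.mem_bot] at hν ⊢
      ext i
      simp [hν, tucker]
  · have h := modelDim_tpcaModel_eq_finrank n m hm hmn hns ⊤ (fun _ _ _ => Submodule.mem_top) hd
    simpa using h
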